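/- **Theorem 1.** Let $X$ be an infinite-dimensional Banach space over $F\in\{\mathbb R,\mathbb C\}$ and let $T:X\to X$ be a linear isometry, i.e. an $F$-linear map with $\|Tx\|=\|x\|$ for all $x$ (surjective or not; in particular, $T$ may be any invertible isometry). Write $\rho(x,K)$ for the distance from a point $x$ to a set $K$ (with $\rho(x,\emptyset)=\infty$). Then: (i) $T$ has no occasionally attracting compact set, that is, there is no compact set $K\subseteq X$ such that $$\liminf_{n\to\infty}\rho(T^nx,K)=0\qquad\text{for every } x\in X \text{ with } \|x\|\le 1.$$ (ii) In the equivalent formulation, $T$ is not compact-supercyclic, that is, there is no compact set $K\subseteq X$ with $0\notin K$ such that the set $$F\cdot O(K)=\{\lambda T^nk : \lambda\in F,\ n\ge 0,\ k\in K\}$$ is dense in $X$. -/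

import Mathlib

open Filter Set

/-- `K` is occasionally attracting for `T`: `liminf ρ(Tⁿ x, K) = 0` for every `x` in the closed
unit ball. The distance is taken in `[0, ∞]`, so that the empty set is at distance `∞` from every
point and is never occasionally attracting. -/
def IsOccasionallyAttracting {X : Type*} [NormedAddCommGroup X] (T : X → X) (K : Set X) : Prop :=
  ∀ x : X, ‖x‖ ≤ 1 → liminf (fun n : ℕ => Metric.infEDist (T^[n] x) K) atTop = 0

/-- The forward orbit `O(K) = ⋃ₙ Tⁿ K` of a set `K`. -/
def setOrbit {X : Type*} (T : X → X) (K : Set X) : Set X :=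
  ⋃ n : ℕ, T^[n] '' K

/-- `T` is compact-supercyclic over the scalar field `𝕜`: there is a compact set `K` with `0 ∉ K`
such that `𝕜 · O(K)` is dense. Without `0 ∉ K` the notion degenerates: in a separable space,
`{0} ∪ {xₙ / n}` with `xₙ` dense in the unit sphere is compact and `𝕜 · K` alone is dense. -/
def IsCompactSupercyclic (𝕜 : Type*) [RCLike 𝕜] {X : Type*} [NormedAddCommGroup X]
    [NormedSpace 𝕜 X] (T : X → X) : Prop :=
  ∃ K : Set X, IsCompact K ∧ (0 : X) ∉ K ∧ Dense {y : X | ∃ c : 𝕜, ∃ z ∈ setOrbit T K, y = c • z}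

/-!
Let `T` be an isometry with an occasionally attracting compact set `K`. Every closed invariant set
meeting the unit ball meets `K`, so an operator commuting with `T` that is not bounded below on the
unit sphere of a closed invariant subspace kills a unit vector of `K` there. The frontier of the
spectrum of `T` on such a subspace is unimodular and consists of approximate eigenvalues, hence `K`
contains a unimodular eigenvector in every nonzero closed invariant subspace. By the mean ergodic
theorem, unimodular eigenvectors stay away from the closure of the range of `T - λ`; in particular
those with different eigenvalues are uniformly separated, and only finitely many eigenvalues occur
in `K`. If `p` is the product of the corresponding `z - λ`, the closure of the range of `p(T)`
contains no unimodular eigenvector of `K`, so `p(T) = 0`. Thus `T` is algebraic, the isometries in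
the finite-dimensional algebra it generates form a compact group `G`, and the closed orbit `G x` of
each `x` in the unit ball meets `K`, so that ball is contained in the compact set `G K`.

Over the reals `T - λ` is replaced by the quadratic `(T - λ)(T - conj λ)`, which is also how complex
spaces are treated, after restriction of scalars.

If `T` is compact-supercyclic, then it is surjective, and approximating `x` by `λ Tⁿ k` amounts to
approximating `T⁻ⁿ x` by `λ k`, where `λ k` stays in a compact set as long as it is bounded.
-/

section ApproximateEigenvalue

variable {E : Type*} [NormedAddCommGroup E] [CompleteSpace E]

theorem isUnit_of_mem_closure_isUnit_of_bound {𝕜 : Type*} [NontriviallyNormedField 𝕜]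
    [NormedSpace 𝕜 E] {A : E →L[𝕜] E} {c : ℝ} (hc : 0 < c) (hA : ∀ x, c * ‖x‖ ≤ ‖A x‖)
    (hcl : A ∈ closure {B : E →L[𝕜] E | IsUnit B}) : IsUnit A := by
  nontriviality E →L[𝕜] E
  obtain ⟨_, ⟨B, rfl⟩, hAB⟩ := Metric.mem_closure_iff.1 hcl (c / 2) (half_pos hc)
  rw [dist_eq_norm] at hAB
  have hB : ∀ x, c / 2 * ‖x‖ ≤ ‖(B : E →L[𝕜] E) x‖ := fun x => by
    have hsub := (A - B).le_of_opNorm_le hAB.le x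
    rw [sub_apply] at hsub
    linarith [hA x, norm_sub_norm_le (A x) ((B : E →L[𝕜] E) x)]
  have hBinv : ‖(↑B⁻¹ : E →L[𝕜] E)‖ ≤ (c / 2)⁻¹ := by
    refine ContinuousLinearMap.opNorm_le_bound _ (by positivity) fun y => ?_
    have hy : (B : E →L[𝕜] E) ((↑B⁻¹ : E →L[𝕜] E) y) = y :=
      congrArg (fun D : E →L[𝕜] E => D y) B.mul_inv
    rw [← div_eq_inv_mul, le_div_iff₀' (half_pos hc)]
    simpa only [hy] using hB ((↑B⁻¹ : E →L[𝕜] E) y)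
  exact (B.ofNearby A (hAB.trans_le
    ((le_inv_comm₀ B⁻¹.norm_pos (half_pos hc)).1 hBinv))).isUnit

theorem exists_norm_map_sub_smul_lt_of_mem_frontier_spectrum {𝕜 : Type*} [RCLike 𝕜]
    [NormedSpace 𝕜 E] {A : E →L[𝕜] E} {l : 𝕜} (hl : l ∈ frontier (spectrum 𝕜 A)) {ε : ℝ}
    (hε : 0 < ε) : ∃ x, ‖x‖ = 1 ∧ ‖A x - l • x‖ < ε := by
  rw [frontier_eq_closure_inter_closure, (spectrum.isClosed A).closure_eq] at hl
  by_contra! h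
  refine hl.1 (isUnit_of_mem_closure_isUnit_of_bound hε (fun x => ?_)
    (map_mem_closure (f := fun m => algebraMap 𝕜 (E →L[𝕜] E) m - A) (by fun_prop) hl.2
      fun m hm => not_not.1 hm))
  have happly : (algebraMap 𝕜 (E →L[𝕜] E) l - A) x = -(A x - l • x) := by
    simp [Algebra.algebraMap_eq_smul_one]
  rw [happly, norm_neg]
  obtain rfl | hx := eq_or_ne x 0
  · simp
  have := h ((‖x‖⁻¹ : 𝕜) • x) (norm_smul_inv_norm hx)
  rw [map_smul, smul_comm, ← smul_sub, norm_smul, norm_inv, norm_algebraMap', norm_norm,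
    inv_mul_eq_div, le_div_iff₀ (norm_pos_iff.2 hx)] at this
  exact this

variable [NormedSpace ℂ E]

theorem exists_norm_eq_one_forall_norm_map_sub_smul_lt [Nontrivial E] (U : E →L[ℂ] E)
    (hU : ∀ x, ‖U x‖ = ‖x‖) :
    ∃ l : ℂ, ‖l‖ = 1 ∧ ∀ ε > 0, ∃ x, ‖x‖ = 1 ∧ ‖U x - l • x‖ < ε := by
  obtain ⟨l, hl⟩ : (frontier (spectrum ℂ U)).Nonempty := nonempty_frontier_iff.2
    ⟨spectrum.nonempty U, fun h => NormedSpace.unbounded_univ ℂ ℂ (h ▸ spectrum.isBounded U)⟩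
  have happ := fun ε (hε : 0 < ε) => exists_norm_map_sub_smul_lt_of_mem_frontier_spectrum hl hε
  refine ⟨l, eq_of_abs_sub_le_all fun ε hε => ?_, happ⟩
  obtain ⟨x, hx, hlt⟩ := happ ε hε
  have := (abs_norm_sub_norm_le (U x) (l • x)).trans hlt.le
  rwa [norm_smul, hU, hx, mul_one, abs_sub_comm] at this

end ApproximateEigenvalue

section MeanErgodic

variable {𝕜 E : Type*} [RCLike 𝕜] [NormedAddCommGroup E] [NormedSpace 𝕜 E]

theorem norm_iterate_le_of_forall_norm_map_le {A : E → E} (hA : ∀ x, ‖A x‖ ≤ ‖x‖) (n : ℕ) (x : E) :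
    ‖A^[n] x‖ ≤ ‖x‖ := by
  induction n with
  | zero => rfl
  | succ n ih => exact (Function.iterate_succ_apply' A n x ▸ hA _).trans ih

theorem norm_le_norm_sub_map_sub_self {A : E →ₗ[𝕜] E} (hA : ∀ x, ‖A x‖ ≤ ‖x‖) {u : E}
    (hu : A u = u) (w : E) : ‖u‖ ≤ ‖u - (A w - w)‖ := by
  have telescope (N : ℕ) : ‖N • u - (A^[N] w - w)‖ ≤ N * ‖u - (A w - w)‖ := by
    induction N with
    | zero => simp
    | succ N ih =>
      have hstep : (N + 1) • u - (A^[N + 1] w - w) =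
          A (N • u - (A^[N] w - w)) + (u - (A w - w)) := by
        rw [Function.iterate_succ_apply', map_sub, map_sub, map_nsmul, hu, succ_nsmul]
        abel
      rw [hstep, Nat.cast_succ, add_one_mul]
      exact (norm_add_le _ _).trans (add_le_add_left ((hA _).trans ih) _)
  have hbound (N : ℕ) : N * (‖u‖ - ‖u - (A w - w)‖) ≤ 2 * ‖w‖ := by
    have hN := telescope N
    have := norm_sub_norm_le (N • u) (A^[N] w - w)
    have := norm_sub_le (A^[N] w) w
    rw [← Nat.cast_smul_eq_nsmul 𝕜, norm_smul, RCLike.norm_natCast] at *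
    linarith [norm_iterate_le_of_forall_norm_map_le hA N w]
  by_contra! hlt
  obtain ⟨N, hN⟩ := exists_nat_gt (2 * ‖w‖ / (‖u‖ - ‖u - (A w - w)‖))
  rw [div_lt_iff₀ (sub_pos.2 hlt)] at hN
  exact (hbound N).not_gt hN

theorem norm_le_norm_sub_map_sub_smul {A : E →ₗ[𝕜] E} (hA : ∀ x, ‖A x‖ ≤ ‖x‖) {l : 𝕜}
    (hl : ‖l‖ = 1) {u : E} (hu : A u = l • u) (w : E) : ‖u‖ ≤ ‖u - (A w - l • w)‖ := by
  have hl0 : l ≠ 0 := norm_ne_zero_iff.1 (hl ▸ one_ne_zero)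
  have := norm_le_norm_sub_map_sub_self (A := l⁻¹ • A) (u := u)
    (fun x => by simpa [norm_smul, hl] using hA x) (by simp [hu, hl0]) (l • w)
  simpa [hl0] using this

theorem norm_map_sub_smul_le_of_quadratic_eq_zero {A : E →ₗ[𝕜] E} (hA : ∀ x, ‖A x‖ ≤ ‖x‖)
    {l m : 𝕜} (hl : ‖l‖ = 1) {y : E} (hy : A (A y) - (l + m) • A y + (l * m) • y = 0) (x : E) :
    ‖A y - m • y‖ ≤ ‖l - m‖ * ‖y - (A (A x) - (l + m) • A x + (l * m) • x)‖ := by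
  have heigen : A (A y - m • y) = l • (A y - m • y) := by
    rw [← sub_eq_zero, ← hy, map_sub, map_smul]
    module
  have hrange : A y - m • y - (A (y + (l - m) • (A x - m • x)) - l • (y + (l - m) • (A x - m • x)))
      = (l - m) • (y - (A (A x) - (l + m) • A x + (l * m) • x)) := by
    simp only [map_sub, map_add, map_smul]
    module
  rw [← norm_smul, ← hrange]
  exact norm_le_norm_sub_map_sub_smul hA hl heigen _

theorem norm_le_two_mul_norm_sub_of_quadratic_eq_zero {A : E →ₗ[𝕜] E} (hA : ∀ x, ‖A x‖ ≤ ‖x‖)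
    {l m : 𝕜} (hl : ‖l‖ = 1) (hm : ‖m‖ = 1) {y : E}
    (hy : A (A y) - (l + m) • A y + (l * m) • y = 0) (x : E) :
    ‖y‖ ≤ 2 * ‖y - (A (A x) - (l + m) • A x + (l * m) • x)‖ := by
  have hsub_m := norm_map_sub_smul_le_of_quadratic_eq_zero hA hl hy x
  obtain rfl | hlm := eq_or_ne l m
  · have heigen : A y = l • y := by
      rwa [sub_self, norm_zero, zero_mul, norm_le_zero_iff, sub_eq_zero] at hsub_m
    have hrange : A (A x) - (l + l) • A x + (l * l) • x =
        A (A x - l • x) - l • (A x - l • x) := by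
      rw [map_sub, map_smul]
      module
    rw [hrange]
    linarith [norm_le_norm_sub_map_sub_smul hA hl heigen (A x - l • x), norm_nonneg y]
  · have hsub_l := norm_map_sub_smul_le_of_quadratic_eq_zero hA hm
      (by rwa [add_comm m, mul_comm m]) x
    rw [norm_sub_rev m, add_comm m, mul_comm m] at hsub_l
    have hdiff : (l - m) • y = (A y - m • y) - (A y - l • y) := by module
    have := norm_sub_le (A y - m • y) (A y - l • y)
    rw [← hdiff, norm_smul] at this
    exact le_of_mul_le_mul_left (by linarith) (norm_pos_iff.2 (sub_ne_zero.2 hlm))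

end MeanErgodic

/-- The complexification of a real normed space `X`, realised as the space of real-linear maps
`ℂ → X` with the operator norm, on which `ℂ` acts by precomposition. It makes complex spectral
theory available for real operators. -/
def Complexification (X : Type*) [NormedAddCommGroup X] [NormedSpace ℝ X] : Type _ := ℂ →L[ℝ] X

namespace Complexification

variable {X : Type*} [NormedAddCommGroup X] [NormedSpace ℝ X]

noncomputable instance : NormedAddCommGroup (Complexification X) :=
  inferInstanceAs (NormedAddCommGroup (ℂ →L[ℝ] X))

instance [CompleteSpace X] : CompleteSpace (Complexification X) :=
  inferInstanceAs (CompleteSpace (ℂ →L[ℝ] X))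

noncomputable instance : FunLike (Complexification X) ℂ X :=
  inferInstanceAs (FunLike (ℂ →L[ℝ] X) ℂ X)

instance : LinearMapClass (Complexification X) ℝ ℂ X :=
  inferInstanceAs (LinearMapClass (ℂ →L[ℝ] X) ℝ ℂ X)

instance : IsAddApply (Complexification X) ℂ X :=
  inferInstanceAs (IsAddApply (ℂ →L[ℝ] X) ℂ X)

instance : IsSubApply (Complexification X) ℂ X :=
  inferInstanceAs (IsSubApply (ℂ →L[ℝ] X) ℂ X)

instance : IsZeroApply (Complexification X) ℂ X :=
  inferInstanceAs (IsZeroApply (ℂ →L[ℝ] X) ℂ X)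

theorem norm_apply_le (f : Complexification X) (z : ℂ) : ‖f z‖ ≤ ‖f‖ * ‖z‖ :=
  ContinuousLinearMap.le_opNorm f z

theorem norm_le_of_forall_norm_apply_le {f : Complexification X} {C : ℝ} (hC : 0 ≤ C)
    (h : ∀ z, ‖f z‖ ≤ C * ‖z‖) : ‖f‖ ≤ C :=
  ContinuousLinearMap.opNorm_le_bound f hC h

noncomputable instance : SMul ℂ (Complexification X) :=
  ⟨fun c f => ContinuousLinearMap.comp f (ContinuousLinearMap.mul ℝ ℂ c)⟩

theorem smul_apply (c : ℂ) (f : Complexification X) (z : ℂ) : (c • f) z = f (c * z) := rfl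

theorem ofReal_smul_apply (r : ℝ) (f : Complexification X) (z : ℂ) :
    ((r : ℂ) • f) z = r • f z := by
  rw [smul_apply, ← Complex.real_smul, map_smul]

noncomputable instance : NormedSpace ℂ (Complexification X) where
  one_smul f := DFunLike.ext _ _ fun z => by rw [smul_apply, one_mul]
  mul_smul a b f := DFunLike.ext _ _ fun z => by simp only [smul_apply, mul_left_comm, mul_assoc]
  smul_zero _ := rfl
  smul_add _ _ _ := rfl
  add_smul a b f := DFunLike.ext _ _ fun z => by
    simp only [add_apply, smul_apply, add_mul, map_add]
  zero_smul f := DFunLike.ext _ _ fun z => by rw [smul_apply, zero_mul, map_zero, zero_apply]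
  norm_smul_le a f := norm_le_of_forall_norm_apply_le (by positivity) fun z => by
    rw [smul_apply, mul_comm ‖a‖, mul_assoc, ← norm_mul]
    exact norm_apply_le f _

/-- The embedding of a real normed space into its complexification: `x` is sent to the real part
functional with values in `ℝ x`. -/
noncomputable def ofReal : X →+ Complexification X where
  toFun x := Complex.reCLM.smulRight x
  map_zero' := ContinuousLinearMap.ext fun _ => smul_zero _
  map_add' _ _ := ContinuousLinearMap.ext fun _ => smul_add _ _ _

theorem ofReal_apply (x : X) (z : ℂ) : ofReal x z = z.re • x := rfl

theorem norm_ofReal (x : X) : ‖ofReal x‖ = ‖x‖ :=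
  (ContinuousLinearMap.norm_smulRight_apply _ x).trans (by rw [Complex.reCLM_norm, one_mul])

instance [Nontrivial X] : Nontrivial (Complexification X) := by
  obtain ⟨x, hx⟩ := exists_ne (0 : X)
  exact ⟨ofReal x, 0, norm_ne_zero_iff.1 (norm_ofReal x ▸ norm_ne_zero_iff.2 hx)⟩

/-- The complex-linear extension of a real operator to the complexification. -/
noncomputable def extend (L : X →L[ℝ] X) : Complexification X →L[ℂ] Complexification X :=
  LinearMap.mkContinuous
    { toFun := fun f => L.comp f
      map_add' := fun f g => L.comp_add f g
      map_smul' := fun _ _ => rfl } ‖L‖ fun f => L.opNorm_comp_le f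

theorem extend_apply (L : X →L[ℝ] X) (f : Complexification X) (z : ℂ) :
    extend L f z = L (f z) := rfl

theorem norm_extend_apply {L : X →L[ℝ] X} (hL : ∀ x, ‖L x‖ = ‖x‖) (f : Complexification X) :
    ‖extend L f‖ = ‖f‖ := by
  apply le_antisymm <;> refine norm_le_of_forall_norm_apply_le (norm_nonneg _) fun z => ?_
  · rw [extend_apply, hL]
    exact norm_apply_le f z
  · rw [← hL, ← extend_apply]
    exact norm_apply_le _ z

end Complexification

section UnimodularQuadratic

open Polynomial Complexification
open scoped ComplexConjugate

/-- The real quadratic polynomial `X² - 2cX + 1`. For `|c| ≤ 1` its roots are the unimodular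
numbers `c ± i√(1 - c²)`, so it plays the role of `X - λ` with `|λ| = 1` over the reals. -/
noncomputable def unimodularQuadratic (c : ℝ) : ℝ[X] := X ^ 2 - C (2 * c) * X + 1

theorem monic_unimodularQuadratic (c : ℝ) : (unimodularQuadratic c).Monic := by
  unfold unimodularQuadratic
  monicity!

theorem aeval_apply_map {𝕜 E : Type*} [NormedField 𝕜] [NormedAddCommGroup E] [NormedSpace 𝕜 E]
    (p : 𝕜[X]) (A : E →L[𝕜] E) (x : E) : aeval A p (A x) = A (aeval A p x) := by
  simpa using congrArg (fun q => aeval A q x) (mul_comm p X)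

variable {X : Type*} [NormedAddCommGroup X] [NormedSpace ℝ X] {L : X →L[ℝ] X}

theorem aeval_unimodularQuadratic_apply (c : ℝ) (L : X →L[ℝ] X) (x : X) :
    aeval L (unimodularQuadratic c) x = L (L x) - (2 * c) • L x + x := by
  simp [unimodularQuadratic, pow_two, Algebra.algebraMap_eq_smul_one, mul_smul, smul_comm c]

theorem extend_quadratic_apply {l : ℂ} (hl : ‖l‖ = 1) (L : X →L[ℝ] X) (f : Complexification X)
    (z : ℂ) :
    (extend L (extend L f) - (l + conj l) • extend L f + (l * conj l) • f) z =
      aeval L (unimodularQuadratic l.re) (f z) := by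
  have hl' : l * conj l = (1 : ℝ) := by
    rw [Complex.mul_conj, Complex.normSq_eq_norm_sq, hl, one_pow]
  rw [hl', Complex.add_conj, aeval_unimodularQuadratic_apply, add_apply, sub_apply,
    ofReal_smul_apply, ofReal_smul_apply, one_smul]
  rfl

theorem extend_quadratic_ofReal {l : ℂ} (hl : ‖l‖ = 1) (L : X →L[ℝ] X) (x : X) :
    extend L (extend L (ofReal x)) - (l + conj l) • extend L (ofReal x) + (l * conj l) • ofReal x =
      ofReal (aeval L (unimodularQuadratic l.re) x) :=
  DFunLike.ext _ _ fun z => by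
    rw [extend_quadratic_apply hl, ofReal_apply, ofReal_apply, map_smul]

theorem exists_forall_norm_aeval_unimodularQuadratic_lt [CompleteSpace X] [Nontrivial X]
    (hL : ∀ x, ‖L x‖ = ‖x‖) :
    ∃ c ∈ Icc (-1 : ℝ) 1, ∀ ε > 0, ∃ x, ‖x‖ = 1 ∧ ‖aeval L (unimodularQuadratic c) x‖ < ε := by
  obtain ⟨l, hl, happ⟩ := exists_norm_eq_one_forall_norm_map_sub_smul_lt
    (extend L) (norm_extend_apply hL)
  refine ⟨l.re, abs_le.1 (hl ▸ Complex.abs_re_le_norm l), fun ε hε => ?_⟩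
  obtain ⟨f, hf, hfε⟩ := happ (ε / 4) (by positivity)
  set U := extend L
  obtain ⟨z, hz⟩ : ∃ z, 1 / 2 * ‖z‖ < ‖f z‖ := by
    by_contra! h
    linarith [norm_le_of_forall_norm_apply_le (by norm_num) h]
  have hquad : ‖U (U f) - (l + conj l) • U f + (l * conj l) • f‖ ≤ ε / 2 := by
    have hfactor : U (U f) - (l + conj l) • U f + (l * conj l) • f =
        U (U f - l • f) - conj l • (U f - l • f) := by
      rw [map_sub, map_smul]
      module
    rw [hfactor]
    refine (norm_sub_le _ _).trans ?_
    rw [norm_extend_apply hL, norm_smul, RCLike.norm_conj, hl]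
    linarith
  have hfz : 0 < ‖f z‖ := (by positivity : 0 ≤ 1 / 2 * ‖z‖).trans_lt hz
  refine ⟨‖f z‖⁻¹ • f z, norm_smul_inv_norm (𝕜 := ℝ) (norm_pos_iff.1 hfz), ?_⟩
  rw [map_smul, norm_smul, norm_inv, norm_norm, inv_mul_lt_iff₀ hfz, ← extend_quadratic_apply hl]
  calc _ ≤ ε / 2 * ‖z‖ := (norm_apply_le _ z).trans (by gcongr)
    _ < ‖f z‖ * ε := by nlinarith

theorem norm_le_two_mul_norm_sub_aeval_unimodularQuadratic (hL : ∀ x, ‖L x‖ = ‖x‖) {c : ℝ}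
    (hc : c ∈ Icc (-1 : ℝ) 1) {y : X} (hy : aeval L (unimodularQuadratic c) y = 0) (x : X) :
    ‖y‖ ≤ 2 * ‖y - aeval L (unimodularQuadratic c) x‖ := by
  obtain ⟨l, hl, rfl⟩ : ∃ l : ℂ, ‖l‖ = 1 ∧ l.re = c :=
    ⟨Complex.exp (Real.arccos c * Complex.I), Complex.norm_exp_ofReal_mul_I _, by
      rw [Complex.exp_ofReal_mul_I_re, Real.cos_arccos hc.1 hc.2]⟩
  have hbound := norm_le_two_mul_norm_sub_of_quadratic_eq_zero (A := (extend L).toLinearMap)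
    (fun f => (norm_extend_apply hL f).le) hl ((RCLike.norm_conj l).trans hl) (y := ofReal y)
    ((extend_quadratic_ofReal hl L y).trans (by rw [hy, map_zero])) (ofReal x)
  simp only [ContinuousLinearMap.coe_coe] at hbound
  rwa [extend_quadratic_ofReal hl, ← map_sub, norm_ofReal, norm_ofReal] at hbound

theorem norm_le_two_mul_norm_sub_of_aeval_unimodularQuadratic_eq_zero (hL : ∀ x, ‖L x‖ = ‖x‖)
    {c d : ℝ} (hc : c ∈ Icc (-1 : ℝ) 1) (hcd : c ≠ d) {x y : X}
    (hx : aeval L (unimodularQuadratic c) x = 0) (hy : aeval L (unimodularQuadratic d) y = 0) :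
    ‖x‖ ≤ 2 * ‖x - y‖ := by
  -- On the kernel of `L² - 2dL + 1` the operator `L² - 2cL + 1` acts as `2(d - c)L`.
  have hrange : aeval L (unimodularQuadratic c) ((2 * (d - c))⁻¹ • y) = L y := by
    rw [aeval_unimodularQuadratic_apply] at hy
    rw [map_smul, inv_smul_eq_iff₀ (mul_ne_zero two_ne_zero (sub_ne_zero.2 hcd.symm)),
      aeval_unimodularQuadratic_apply, ← sub_eq_zero, ← hy]
    module
  have hLx : aeval L (unimodularQuadratic c) (L x) = 0 := by rw [aeval_apply_map, hx, map_zero]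
  have := norm_le_two_mul_norm_sub_aeval_unimodularQuadratic hL hc hLx ((2 * (d - c))⁻¹ • y)
  rwa [hrange, ← map_sub, hL, hL] at this

end UnimodularQuadratic

section OccasionalAttraction

open Metric Polynomial

section NormedGroup

variable {X : Type*} [NormedAddCommGroup X] {T : X → X} {K : Set X}

theorem IsOccasionallyAttracting.exists_iterate_mem_thickening (h : IsOccasionallyAttracting T K)
    {x : X} (hx : ‖x‖ ≤ 1) {ε : ℝ} (hε : 0 < ε) : ∃ n, T^[n] x ∈ thickening ε K :=
  (frequently_lt_of_liminf_lt (h := (h x hx).trans_lt (ENNReal.ofReal_pos.2 hε))).exists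

theorem isOccasionallyAttracting_of_forall_exists_mem_thickening (hT : ∀ x, ‖T x‖ ≤ ‖x‖)
    (h : ∀ x, ‖x‖ ≤ 1 → ∀ ε > 0, ∃ n, T^[n] x ∈ thickening ε K) :
    IsOccasionallyAttracting T K := by
  intro x hx
  refine nonpos_iff_eq_zero.1 (ENNReal.le_of_forall_pos_le_add fun ε hε _ => ?_)
  rw [zero_add]
  refine liminf_le_of_frequently_le' (frequently_atTop.2 fun N => ?_)
  obtain ⟨n, hn⟩ := h (T^[N] x) ((norm_iterate_le_of_forall_norm_map_le hT N x).trans hx) ε hε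
  rw [← Function.iterate_add_apply, mem_thickening_iff_infEDist_lt, ENNReal.ofReal_coe_nnreal] at hn
  exact ⟨n + N, Nat.le_add_left N n, hn.le⟩

theorem IsOccasionallyAttracting.inter_nonempty_of_mapsTo (h : IsOccasionallyAttracting T K)
    (hK : IsCompact K) {S : Set X} (hS : IsClosed S) (hTS : MapsTo T S S) {x : X} (hxS : x ∈ S)
    (hx : ‖x‖ ≤ 1) : (K ∩ S).Nonempty := by
  by_contra hempty
  obtain ⟨δ, hδ, hsub⟩ := hK.exists_thickening_subset_open hS.isOpen_compl
    (subset_compl_iff_disjoint_right.2 (disjoint_iff_inter_eq_empty.2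
      (not_nonempty_iff_eq_empty.1 hempty)))
  obtain ⟨n, hn⟩ := h.exists_iterate_mem_thickening hx hδ
  exact hsub hn (hTS.iterate n hxS)

theorem IsOccasionallyAttracting.exists_mem_inter_map_eq_zero (h : IsOccasionallyAttracting T K)
    (hK : IsCompact K) (hT : ∀ x, ‖T x‖ = ‖x‖) {A : X → X} (hA : Continuous A)
    (hAT : Function.Commute A T) {S : Set X} (hS : IsClosed S) (hTS : MapsTo T S S)
    (happ : ∀ ε > 0, ∃ x ∈ S, ‖x‖ = 1 ∧ ‖A x‖ < ε) : ∃ k ∈ K ∩ S, ‖k‖ = 1 ∧ A k = 0 := by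
  have hmeet : ∀ ε > 0, ∃ k ∈ K ∩ (S ∩ {x | ‖x‖ = 1}), ‖A k‖ ≤ ε := fun ε hε => by
    obtain ⟨x, hxS, hx, hAx⟩ := happ ε hε
    obtain ⟨k, hkK, hk⟩ := h.inter_nonempty_of_mapsTo hK
      (S := (S ∩ {x | ‖x‖ = 1}) ∩ {x | ‖A x‖ ≤ ε})
      ((hS.inter (isClosed_eq continuous_norm continuous_const)).inter
        (isClosed_le hA.norm continuous_const))
      (fun y hy => ⟨⟨hTS hy.1.1, (hT y).trans hy.1.2⟩, by
        rw [mem_ofPred_eq, hAT y, hT]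
        exact hy.2⟩) ⟨⟨hxS, hx⟩, hAx.le⟩ hx.le
    exact ⟨k, ⟨hkK, hk.1⟩, hk.2⟩
  obtain ⟨k₁, hk₁, -⟩ := hmeet 1 one_pos
  obtain ⟨k, ⟨hkK, hkS, hk⟩, hmin⟩ := (hK.inter_right
    (hS.inter (isClosed_eq continuous_norm continuous_const))).exists_isMinOn ⟨k₁, hk₁⟩
    hA.norm.continuousOn
  refine ⟨k, ⟨hkK, hkS⟩, hk, norm_le_zero_iff.1 (le_of_forall_pos_le_add fun ε hε => ?_)⟩
  obtain ⟨k', hk', hle⟩ := hmeet ε hε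
  rw [zero_add]
  exact (hmin hk').trans hle

end NormedGroup

variable {X : Type*} [NormedAddCommGroup X] [NormedSpace ℝ X] {L : X →L[ℝ] X} {K : Set X}

theorem IsOccasionallyAttracting.exists_aeval_unimodularQuadratic_eq_zero [CompleteSpace X]
    (h : IsOccasionallyAttracting L K) (hK : IsCompact K) (hL : ∀ x, ‖L x‖ = ‖x‖)
    {Y : Submodule ℝ X} (hY : IsClosed (Y : Set X)) (hLY : MapsTo L Y Y) (hbot : Y ≠ ⊥) :
    ∃ c ∈ Icc (-1 : ℝ) 1, ∃ k ∈ K ∩ Y, ‖k‖ = 1 ∧ aeval L (unimodularQuadratic c) k = 0 := by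
  have : Nontrivial Y := Submodule.nontrivial_iff_ne_bot.2 hbot
  have : CompleteSpace Y := hY.completeSpace_coe
  obtain ⟨c, hc, happ⟩ := exists_forall_norm_aeval_unimodularQuadratic_lt
    (L := (L.comp Y.subtypeL).codRestrict Y fun y => hLY y.2) fun y => hL y
  refine ⟨c, hc, h.exists_mem_inter_map_eq_zero hK hL (aeval L (unimodularQuadratic c)).continuous
    (aeval_apply_map _ L) hY hLY fun ε hε => ?_⟩
  obtain ⟨y, hy, hlt⟩ := happ ε hε
  rw [aeval_unimodularQuadratic_apply] at hlt
  exact ⟨y, y.2, hy, by rwa [aeval_unimodularQuadratic_apply]⟩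

theorem finite_setOf_exists_aeval_unimodularQuadratic_eq_zero (hL : ∀ x, ‖L x‖ = ‖x‖)
    (hK : IsCompact K) :
    {c ∈ Icc (-1 : ℝ) 1 | ∃ k ∈ K, ‖k‖ = 1 ∧ aeval L (unimodularQuadratic c) k = 0}.Finite := by
  by_contra hinf
  let c := Set.Infinite.natEmbedding _ hinf
  choose hc k hkK hk1 hk using fun n => (c n).2
  have hsep (m n : ℕ) (hmn : m ≠ n) : 1 / 2 ≤ dist (k m) (k n) := by
    have := norm_le_two_mul_norm_sub_of_aeval_unimodularQuadratic_eq_zero hL (hc m)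
      (fun h => hmn (c.injective (Subtype.ext h))) (hk m) (hk n)
    rw [hk1] at this
    rw [dist_eq_norm]
    linarith
  obtain ⟨_, -, φ, hφ, ha⟩ := hK.tendsto_subseq hkK
  obtain ⟨N, hN⟩ := Metric.cauchySeq_iff.1 ha.cauchySeq (1 / 2) (by norm_num)
  exact (hN N le_rfl (N + 1) N.le_succ).not_ge (hsep _ _ (hφ.injective.ne N.succ_ne_self.symm))

theorem IsOccasionallyAttracting.isIntegral [CompleteSpace X] (h : IsOccasionallyAttracting L K)
    (hK : IsCompact K) (hL : ∀ x, ‖L x‖ = ‖x‖) : IsIntegral ℝ L := by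
  let s := (finite_setOf_exists_aeval_unimodularQuadratic_eq_zero hL hK).toFinset
  let p := ∏ c ∈ s, unimodularQuadratic c
  refine ⟨p, monic_prod_of_monic _ _ fun c _ => monic_unimodularQuadratic c, ?_⟩
  change aeval L p = 0
  by_contra hp
  let Y := (LinearMap.range (aeval L p : X →ₗ[ℝ] X)).topologicalClosure
  have hbot : Y ≠ ⊥ := fun hbot => hp <| ContinuousLinearMap.ext fun x =>
    (Submodule.eq_bot_iff _).1 hbot _ (Submodule.le_topologicalClosure _ ⟨x, rfl⟩)
  have hLY : MapsTo L Y Y := MapsTo.closure (fun _ ⟨x, hx⟩ => ⟨L x, hx ▸ aeval_apply_map p L x⟩)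
    L.continuous
  obtain ⟨c, hc, k, ⟨hkK, hkY⟩, hk1, hk⟩ := h.exists_aeval_unimodularQuadratic_eq_zero hK hL
    (Submodule.isClosed_topologicalClosure _) hLY hbot
  obtain ⟨r, hr⟩ : unimodularQuadratic c ∣ p :=
    Finset.dvd_prod_of_mem _ ((Set.Finite.mem_toFinset _).2 ⟨hc, k, hkK, hk1, hk⟩)
  have hfar : ∀ y ∈ Y, ‖k‖ ≤ 2 * ‖k - y‖ := fun y hy =>
    closure_minimal (t := {y | ‖k‖ ≤ 2 * ‖k - y‖}) (by
      rintro _ ⟨x, rfl⟩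
      have hx : aeval L p x = aeval L (unimodularQuadratic c) (aeval L r x) := by
        rw [hr, map_mul]; rfl
      exact hx ▸ norm_le_two_mul_norm_sub_aeval_unimodularQuadratic hL hc hk _)
      (isClosed_le continuous_const (by fun_prop)) hy
  have := hfar k hkY
  rw [sub_self, norm_zero, hk1] at this
  norm_num at this

theorem isCompact_setOf_forall_norm_apply_eq (S : Submodule ℝ (X →L[ℝ] X))
    [FiniteDimensional ℝ S] : IsCompact {B : S | ∀ x, ‖B.1 x‖ = ‖x‖} := by
  have : ProperSpace S := FiniteDimensional.proper_real S
  refine (isCompact_closedBall 0 1).of_isClosed_subset ?_ fun B hB => mem_closedBall_zero_iff.2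
    (B.1.opNorm_le_bound zero_le_one fun x => (hB x).trans_le (one_mul ‖x‖).ge)
  simp only [ofPred_forall]
  exact isClosed_iInter fun x => isClosed_eq (by fun_prop) continuous_const

theorem exists_mul_eq_one_of_forall_norm_apply_eq (S : Subalgebra ℝ (X →L[ℝ] X))
    [FiniteDimensional ℝ S] {B : S} (hB : ∀ x, ‖B.1 x‖ = ‖x‖) :
    ∃ D : S, D * B = 1 ∧ ∀ x, ‖D.1 x‖ = ‖x‖ := by
  have hcancel : Function.Injective (LinearMap.mulLeft ℝ B) :=
    (injective_iff_map_eq_zero _).2 fun D hD => Subtype.ext <| ContinuousLinearMap.ext fun x =>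
      norm_eq_zero.1 ((hB _).symm.trans (norm_eq_zero.2 (congrArg (fun F : S => F.1 x) hD)))
  obtain ⟨D, hBD : B * D = 1⟩ := LinearMap.surjective_of_injective hcancel 1
  refine ⟨D, hcancel ?_, fun x => ?_⟩
  · rw [LinearMap.mulLeft_apply, LinearMap.mulLeft_apply, ← mul_assoc, hBD, one_mul, mul_one]
  · rw [← hB]
    exact congrArg (fun F : S => ‖F.1 x‖) hBD

theorem IsOccasionallyAttracting.isCompact_closedBall [CompleteSpace X]
    (h : IsOccasionallyAttracting L K) (hK : IsCompact K) (hL : ∀ x, ‖L x‖ = ‖x‖) :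
    IsCompact (closedBall (0 : X) 1) := by
  let S := Algebra.adjoin ℝ {L}
  have : FiniteDimensional ℝ S := Algebra.finite_adjoin_simple_of_isIntegral (h.isIntegral hK hL)
  let G : Set S := {B | ∀ x, ‖B.1 x‖ = ‖x‖}
  have hG : IsCompact G := isCompact_setOf_forall_norm_apply_eq S.toSubmodule
  have hGK : IsCompact ((fun p : S × X => p.1.1 p.2) '' (G ×ˢ K)) :=
    (hG.prod hK).image ((continuous_subtype_val.comp continuous_fst).clm_apply continuous_snd)
  refine hGK.of_isClosed_subset isClosed_closedBall fun x hx => ?_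
  have hGx : IsClosed ((fun B : S => B.1 x) '' G) :=
    (hG.image (by fun_prop : Continuous fun B : S => B.1 x)).isClosed
  have hLGx : MapsTo L ((fun B : S => B.1 x) '' G) ((fun B : S => B.1 x) '' G) := by
    rintro _ ⟨B, hB, rfl⟩
    exact ⟨(⟨L, Algebra.self_mem_adjoin_singleton ℝ L⟩ : S) * B, fun y => (hL _).trans (hB y), rfl⟩
  obtain ⟨_, hk, B, hB, rfl⟩ := h.inter_nonempty_of_mapsTo hK hGx hLGx ⟨1, fun _ => rfl, rfl⟩
    (mem_closedBall_zero_iff.1 hx)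
  obtain ⟨D, hDB, hD⟩ := exists_mul_eq_one_of_forall_norm_apply_eq S hB
  exact ⟨(D, B.1 x), ⟨hD, hk⟩, congrArg (fun F : S => F.1 x) hDB⟩

theorem IsOccasionallyAttracting.finiteDimensional {𝕜 X : Type*} [RCLike 𝕜]
    [NormedAddCommGroup X] [NormedSpace 𝕜 X] [CompleteSpace X] {T : X →ₗᵢ[𝕜] X} {K : Set X}
    (h : IsOccasionallyAttracting T K) (hK : IsCompact K) : FiniteDimensional 𝕜 X := by
  let _ : NormedSpace ℝ X := NormedSpace.restrictScalars ℝ 𝕜 X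
  have : IsScalarTower ℝ 𝕜 X := IsScalarTower.of_algebraMap_smul fun _ _ => rfl
  let L : X →L[ℝ] X := T.toContinuousLinearMap.restrictScalars ℝ
  exact FiniteDimensional.of_isCompact_closedBall 𝕜 one_pos
    (IsOccasionallyAttracting.isCompact_closedBall (L := L) h hK T.norm_map)

end OccasionalAttraction

section Supercyclicity

open Topology

variable {𝕜 X : Type*} [RCLike 𝕜] [NormedAddCommGroup X] [NormedSpace 𝕜 X]

theorem exists_isCompact_forall_smul_mem {K : Set X} (hK : IsCompact K) (h0 : (0 : X) ∉ K)
    (R : ℝ) : ∃ C : Set X, IsCompact C ∧ ∀ c : 𝕜, ∀ k ∈ K, ‖c • k‖ ≤ R → c • k ∈ C := by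
  obtain ⟨m, hm, hmK⟩ : ∃ m > 0, ∀ k ∈ K, m ≤ ‖k‖ := by
    obtain ⟨m, hm, hsub⟩ := Metric.isOpen_iff.1 hK.isClosed.isOpen_compl 0 h0
    exact ⟨m, hm, fun k hk => not_lt.1 fun hlt => hsub (mem_ball_zero_iff.2 hlt) hk⟩
  refine ⟨_, ((isCompact_closedBall (0 : 𝕜) (R / m)).prod hK).image continuous_smul,
    fun c k hk hck => ⟨(c, k), ⟨?_, hk⟩, rfl⟩⟩
  rw [mem_closedBall_zero_iff, le_div_iff₀ hm]
  exact (mul_le_mul_of_nonneg_left (hmK k hk) (norm_nonneg c)).trans (norm_smul c k ▸ hck)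

theorem IsCompactSupercyclic.surjective [CompleteSpace X] {T : X →ₗᵢ[𝕜] X}
    (h : IsCompactSupercyclic 𝕜 T) (hX : ¬FiniteDimensional 𝕜 X) : Function.Surjective T := by
  obtain ⟨K, hK, h0, hd⟩ := h
  by_contra hT
  obtain ⟨x, hx⟩ := not_forall.1 hT
  let V := (range T)ᶜ ∩ Metric.ball 0 (‖x‖ + 1)
  have hV : IsOpen V := T.isometry.isClosedEmbedding.isClosed_range.isOpen_compl.inter
    Metric.isOpen_ball
  obtain ⟨C, hC, hKC⟩ := exists_isCompact_forall_smul_mem (𝕜 := 𝕜) hK h0 (‖x‖ + 1)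
  have hVC : V ⊆ C := by
    refine (hd.open_subset_closure_inter hV).trans (closure_minimal ?_ hC.isClosed)
    rintro _ ⟨⟨hrange, hball⟩, c, z, hz, rfl⟩
    obtain ⟨n, k, hk, rfl⟩ := mem_iUnion.1 hz
    cases n with
    | zero => exact hKC c k hk (mem_ball_zero_iff.1 hball).le
    | succ n =>
      refine absurd ⟨c • T^[n] k, ?_⟩ hrange
      rw [map_smul, Function.iterate_succ_apply']
  have hxC : C ∈ 𝓝 x :=
    mem_of_superset (hV.mem_nhds ⟨hx, mem_ball_zero_iff.2 (lt_add_one _)⟩) hVC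
  have := hC.locallyCompactSpace_of_mem_nhds_of_addGroup hxC
  exact hX (FiniteDimensional.of_locallyCompactSpace 𝕜)

theorem IsCompactSupercyclic.exists_isOccasionallyAttracting_symm {e : X ≃ₗᵢ[𝕜] X}
    (h : IsCompactSupercyclic 𝕜 e) : ∃ C, IsCompact C ∧ IsOccasionallyAttracting e.symm C := by
  obtain ⟨K, hK, h0, hd⟩ := h
  obtain ⟨C, hC, hKC⟩ := exists_isCompact_forall_smul_mem (𝕜 := 𝕜) hK h0 2
  refine ⟨C, hC, isOccasionallyAttracting_of_forall_exists_mem_thickening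
    (fun y => (e.symm.norm_map y).le) fun x hx ε hε => ?_⟩
  obtain ⟨_, hdist, c, z, hz, rfl⟩ := Metric.dense_iff.1 hd x (min ε 1) (by positivity)
  obtain ⟨n, k, hk, rfl⟩ := mem_iUnion.1 hz
  rw [Metric.mem_ball', lt_min_iff] at hdist
  let g : X →ₗᵢ[𝕜] X := e.symm.toLinearIsometry ^ n
  have hg : ⇑g = e.symm^[n] := LinearIsometry.coe_pow _ _
  have hinv : g (c • e^[n] k) = c • k := by
    rw [map_smul, hg, Function.LeftInverse.iterate (f := e) e.symm_apply_apply]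
  refine ⟨n, Metric.mem_thickening_iff.2 ⟨c • k, hKC c k hk ?_, ?_⟩⟩
  · rw [← hinv, g.norm_map]
    rw [dist_comm, dist_eq_norm] at hdist
    linarith [norm_sub_norm_le (c • e^[n] k) x]
  · rw [← hg, ← hinv, g.dist_map]
    exact hdist.1

end Supercyclicity

theorem theorem1 {𝕜 : Type*} [RCLike 𝕜] {X : Type*} [NormedAddCommGroup X] [NormedSpace 𝕜 X]
    [CompleteSpace X] (hX : ¬ FiniteDimensional 𝕜 X) (T : X →ₗᵢ[𝕜] X) :
    (¬ ∃ K : Set X, IsCompact K ∧ IsOccasionallyAttracting T K) ∧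
      ¬ IsCompactSupercyclic 𝕜 T := by
  have no_attracting (S : X →ₗᵢ[𝕜] X) :
      ¬ ∃ K : Set X, IsCompact K ∧ IsOccasionallyAttracting S K :=
    fun ⟨_, hK, h⟩ => hX (h.finiteDimensional hK)
  refine ⟨no_attracting T, fun h => ?_⟩
  let e := LinearIsometryEquiv.ofSurjective T (h.surjective hX)
  have he : IsCompactSupercyclic 𝕜 e := h
  exact no_attracting e.symm.toLinearIsometry he.exists_isOccasionallyAttracting_symm
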